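/- Let $(\Omega,\mathcal F,\mathbb F,\mathbb Q)$ be a filtered probability space carrying two independent one-dimensional $\mathbb F$-Brownian motions $W^E,W^I$. Let $\tau_2>0$ and let $\sigma_E,\sigma_I\in L^2([0,\tau_2])$ be deterministic volatilities. For $i\in\{E,I\}$ and today's price $F^i(0)>0$ the futures price is $$F^i(t)=F^i(0)\,Y_i(t),\qquad Y_i(t)=\exp\Big(-\tfrac12\int_0^t\sigma_i^2(u)\,du+\int_0^t\sigma_i(u)\,dW^i(u)\Big),\qquad 0\le t\le\tau_2,$$ the explicit solution of $dF^i(t)=\sigma_i(t)F^i(t)\,dW^i(t)$; its diffusion coefficient is $\hat\sigma_i(t,x)=\sigma_i(t)\,x$. Let $g,h:\mathbb R\to\mathbb R$ be measurable with $\mathbb E[g^2(F^E(\tau_2))]<\infty$ and $\mathbb E[h^2(F^I(\tau_2))]<\infty$ for the given $F^E(0),F^I(0)>0$. Assume that $\sigma_I$ is uniformly elliptic on $[0,\tau_2]$: there is $\eta>0$ with $\xi\,\sigma_I(t)\,\sigma_I(t)\,\xi>\eta|\xi|^2$ for all $t\in[0,\tau_2]$ and all real $\xi\neq0$. Let $t_1,\dots,t_n\in(0,\tau_2]$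 be times, one of which is $\tau_2$, and put $$\Upsilon_n=\Big\{a\in L^2([0,\tau_2])\;:\;\int_0^{t_i}a(t)\,dt=1\ \text{ for all } i=1,\dots,n\Big\}.$$ Then, for every $a\in\Upsilon_n$, the Itô integral $$\pi^{\Delta_I}=\int_0^{\tau_2}a(t)\,\hat\sigma_I\big(t,F^I(t)\big)^{-1}Y_I(t)\,dW^I(t)\;=\;\frac1{F^I(0)}\int_0^{\tau_2}\frac{a(t)}{\sigma_I(t)}\,dW^I(t)$$ of a square-integrable integrand exists; $g(F^E(\tau_2))h(F^I(\tau_2))$ is integrable for every initial value of $F^I$ in $(0,\infty)$; $g(F^E(\tau_2))h(F^I(\tau_2))\pi^{\Delta_I}$ is integrable; and the temperature delta, i.e. the derivative of the price with respect to the initial value of $F^I$ at the given point $F^I(0)$, exists and equals $$\Delta_I=\frac{\partial}{\partial F^I(0)}\mathbb E\big[g(F^E(\tau_2))h(F^I(\tau_2))\big]=\mathbb E\big[g(F^E(\tau_2))\,h(F^I(\tau_2))\,\pi^{\Delta_I}\big].$$ -/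

import Mathlib

open MeasureTheory ProbabilityTheory Filter Topology
open scoped NNReal ENNReal

namespace Quanto

variable {Ω : Type*} {m : MeasurableSpace Ω}

/-- `W` is a standard one-dimensional Brownian motion relative to the filtration `𝓕`. -/
structure IsBrownianFor (𝓕 : Filtration ℝ≥0 m) (W : ℝ≥0 → Ω → ℝ) (μ : Measure Ω) : Prop
    extends IsBrownianReal W μ where
  adapted : ∀ t, Measurable[𝓕 t] (W t)
  indep_increment : ∀ s t, s ≤ t →
    Indep (MeasurableSpace.comap (fun ω => W t ω - W s ω) inferInstance) (𝓕 s) μ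

/-- A simple predictable process on `[0, T]`: a finite sum `∑ i, ξ i * 1_(left i, right i]` with
`0 ≤ left i ≤ right i ≤ T` and every `ξ i` bounded and `𝓕 (left i)`-measurable. -/
structure SimpleProcess (𝓕 : Filtration ℝ≥0 m) (T : ℝ) where
  n : ℕ
  left : Fin n → ℝ≥0
  right : Fin n → ℝ≥0
  left_le_right : ∀ i, left i ≤ right i
  right_le : ∀ i, (right i : ℝ) ≤ T
  ξ : Fin n → Ω → ℝ
  measurable_ξ : ∀ i, Measurable[𝓕 (left i)] (ξ i)
  bounded_ξ : ∀ i, ∃ C : ℝ, ∀ ω, |ξ i ω| ≤ C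

namespace SimpleProcess

variable {𝓕 : Filtration ℝ≥0 m} {T : ℝ}

/-- The value of a simple process at time `t`. -/
noncomputable def eval (H : SimpleProcess 𝓕 T) (t : ℝ) (ω : Ω) : ℝ :=
  ∑ i, (Set.Ioc (H.left i : ℝ) (H.right i : ℝ)).indicator (fun _ => H.ξ i ω) t

/-- The elementary stochastic integral of a simple process with respect to `W`. -/
def integral (H : SimpleProcess 𝓕 T) (W : ℝ≥0 → Ω → ℝ) (ω : Ω) : ℝ :=
  ∑ i, H.ξ i ω * (W (H.right i) ω - W (H.left i) ω)

end SimpleProcess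

/-- `X` is (a version of) the Itô integral `∫₀ᵀ u(t) dW(t)` of the square-integrable process `u`:
the `L²(μ)`-limit of the elementary integrals of simple predictable processes which converge to `u`
in `L²([0, T] × Ω)`. -/
def IsItoIntegral (𝓕 : Filtration ℝ≥0 m) (W : ℝ≥0 → Ω → ℝ) (μ : Measure Ω) (T : ℝ)
    (u : ℝ → Ω → ℝ) (X : Ω → ℝ) : Prop :=
  MemLp (fun p : ℝ × Ω => u p.1 p.2) 2 ((volume.restrict (Set.Icc 0 T)).prod μ) ∧
  MemLp X 2 μ ∧
  ∃ H : ℕ → SimpleProcess 𝓕 T,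
    Tendsto (fun k => eLpNorm (fun p : ℝ × Ω => (H k).eval p.1 p.2 - u p.1 p.2) 2
      ((volume.restrict (Set.Icc 0 T)).prod μ)) atTop (𝓝 0) ∧
    Tendsto (fun k => eLpNorm (fun ω => (H k).integral W ω - X ω) 2 μ) atTop (𝓝 0)

open Classical in
/-- The Itô integral `∫₀ᵀ u(t) dW(t)` (zero if `u` has none; unique up to null sets otherwise). -/
noncomputable def itoIntegral (𝓕 : Filtration ℝ≥0 m) (W : ℝ≥0 → Ω → ℝ) (μ : Measure Ω) (T : ℝ)
    (u : ℝ → Ω → ℝ) : Ω → ℝ :=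
  if h : ∃ X, IsItoIntegral 𝓕 W μ T u X then Classical.choose h else 0

/-- `Y(t) = exp (-½ ∫₀ᵗ σ(u)² du + ∫₀ᵗ σ(u) dW(u))`. -/
noncomputable def firstVariation (𝓕 : Filtration ℝ≥0 m) (W : ℝ≥0 → Ω → ℝ) (μ : Measure Ω)
    (σ : ℝ → ℝ) (t : ℝ) (ω : Ω) : ℝ :=
  Real.exp (-(1 / 2) * (∫ u in (0 : ℝ)..t, σ u ^ 2) + itoIntegral 𝓕 W μ t (fun u _ => σ u) ω)

/-- The futures price at time `t` with today's price `x`, that is, the explicit solution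
`F(t) = x * exp (-½ ∫₀ᵗ σ(u)² du + ∫₀ᵗ σ(u) dW(u))` of `dF = σ(t) F dW`, `F(0) = x`. -/
noncomputable def futures (𝓕 : Filtration ℝ≥0 m) (W : ℝ≥0 → Ω → ℝ) (μ : Measure Ω)
    (σ : ℝ → ℝ) (x t : ℝ) (ω : Ω) : ℝ :=
  x * Real.exp
    (-(1 / 2) * (∫ u in (0 : ℝ)..t, σ u ^ 2) + itoIntegral 𝓕 W μ t (fun u _ => σ u) ω)

/-- The diffusion coefficient `(t, x) ↦ σ(t) x` of the equation `dF = σ(t) F dW`. -/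
def diffusionCoeff (σ : ℝ → ℝ) (t x : ℝ) : ℝ := σ t * x

/-- Uniform ellipticity of the (one-dimensional) volatility `σ` on `[0, T]`. -/
def UniformlyElliptic (σ : ℝ → ℝ) (T : ℝ) : Prop :=
  ∃ η : ℝ, 0 < η ∧ ∀ ξ : ℝ, ξ ≠ 0 → ∀ t ∈ Set.Icc 0 T, η * |ξ| ^ 2 < ξ * σ t * σ t * ξ

/-- The set `Υₙ` of all `a ∈ L²([0, T])` whose integral over `[0, tᵢ]` is `1` for `i = 1, …, n`. -/
def Upsilon {n : ℕ} (T : ℝ) (t : Fin n → ℝ) : Set (ℝ → ℝ) :=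
  {a | MemLp a 2 (volume.restrict (Set.Icc 0 T)) ∧ ∀ i, ∫ s in (0 : ℝ)..t i, a s = 1}

/-- The integrand `a(t) σ̂(t, F(t))⁻¹ Y(t)` of the delta weight, with `σ̂` the diffusion
coefficient of the futures price `F` started at `x`. -/
noncomputable def deltaIntegrand (𝓕 : Filtration ℝ≥0 m) (W : ℝ≥0 → Ω → ℝ) (μ : Measure Ω)
    (σ : ℝ → ℝ) (x : ℝ) (a : ℝ → ℝ) (t : ℝ) (ω : Ω) : ℝ :=
  a t * ((diffusionCoeff σ t (futures 𝓕 W μ σ x t ω))⁻¹ * firstVariation 𝓕 W μ σ t ω)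

/-- The Malliavin delta weight `∫₀ᵀ a(t) σ̂(t, F(t))⁻¹ Y(t) dW(t)`. -/
noncomputable def deltaWeight (𝓕 : Filtration ℝ≥0 m) (W : ℝ≥0 → Ω → ℝ) (μ : Measure Ω)
    (σ : ℝ → ℝ) (x : ℝ) (a : ℝ → ℝ) (T : ℝ) : Ω → ℝ :=
  itoIntegral 𝓕 W μ T (deltaIntegrand 𝓕 W μ σ x a)

end Quanto

/-!
Writing `F(t) = x Y(t)`, the factor `σ̂(t, F(t))⁻¹ Y(t)` of the delta weight is `(x σ_I(t))⁻¹`, so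
the weight `P` is the Itô integral of the deterministic function `f = a / (x σ_I)`, which is square
integrable by ellipticity. The theorem is then a statement about Gaussian variables.

*Itô integrals of deterministic functions.* The Itô isometry in bilinear form
(`IsItoIntegral.integral_mul`) determines all inner products of Itô integrals, hence gives their
uniqueness and linearity (`IsItoIntegral.ae_eq_linearCombination`). Step functions are dense in
`L²([0, T])`, which gives existence (`exists_isItoIntegral_deterministic`), and passing to the limit
shows that the integral of `f` has law `N(0, ∫ f²)` (`IsItoIntegral.hasLaw_gaussianReal`) and is a
functional of the path of the Brownian motion (`IsItoIntegral.exists_measurable_comap`). Hence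
integrals against the two independent Brownian motions are independent, and `g(F^E(τ₂))` factors
out of all expectations.

*The weight.* Let `X = ∫ σ_I dW^I`, `s = ∫ σ_I²` and `c = (x s)⁻¹`. Since `∫ a = 1`, the
function `f - c σ_I` is orthogonal to `σ_I`; its integral `R` is therefore a centred variable
independent of `X`, and in `E[k(X) P]` with `P = c X + R` only `c E[k(X) X]` survives
(`integral_mul_deltaWeight`).

*The derivative.* Changing the initial value from `x₀` to `x` translates `X` by `log (x / x₀)`.
By the Cameron–Martin formula (`gaussianReal_map_add_eq_withDensity`) the translation can be moved
to the density, where it can be differentiated for `k` merely square integrable; the derivative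
along `θ ↦ X + θ s` at `0` is `E[k(X) X]` (`hasDerivAt_integral_gaussianReal_shift`). The chain
rule with `θ = log (x / x₀) / s` supplies the same factor `(x₀ s)⁻¹`.
-/

open MeasureTheory ProbabilityTheory Filter Topology
open scoped NNReal ENNReal

namespace Quanto

theorem integrable_fun_mul {α : Type*} {mα : MeasurableSpace α} {ν : Measure α} {f g : α → ℝ}
    (hf : MemLp f 2 ν) (hg : MemLp g 2 ν) : Integrable (fun x => f x * g x) ν :=
  hf.integrable_mul hg

/-! ### Brownian increments -/

section Increments

variable {Ω : Type*} {m : MeasurableSpace Ω} {μ : Measure Ω} {𝓕 : Filtration ℝ≥0 m}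
  {W : ℝ≥0 → Ω → ℝ}

theorem IsBrownianFor.measurable (hW : IsBrownianFor 𝓕 W μ) (t : ℝ≥0) : Measurable (W t) :=
  (hW.adapted t).mono (𝓕.le t) le_rfl

theorem IsBrownianFor.hasLaw_increment (hW : IsBrownianFor 𝓕 W μ) {s t : ℝ≥0} (hst : s ≤ t) :
    HasLaw (fun ω => W t ω - W s ω) (gaussianReal 0 (t - s)) μ := by
  have h := hW.toIsPreBrownianReal.hasLaw_sub t s
  have e : nndist t.1 s.1 = t - s := by
    ext
    rw [coe_nndist, Real.dist_eq, NNReal.coe_sub hst, abs_of_nonneg]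
    · rfl
    · exact sub_nonneg.2 hst
  rw [e] at h
  exact h

theorem IsBrownianFor.memLp_increment (hW : IsBrownianFor 𝓕 W μ) {s t : ℝ≥0} (hst : s ≤ t) :
    MemLp (fun ω => W t ω - W s ω) 2 μ :=
  (hW.hasLaw_increment hst).hasGaussianLaw.memLp_two

theorem IsBrownianFor.integral_increment (hW : IsBrownianFor 𝓕 W μ) {s t : ℝ≥0} (hst : s ≤ t) :
    ∫ ω, (W t ω - W s ω) ∂μ = 0 := by
  rw [(hW.hasLaw_increment hst).integral_eq, integral_id_gaussianReal]

theorem IsBrownianFor.integral_increment_sq (hW : IsBrownianFor 𝓕 W μ) {s t : ℝ≥0}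
    (hst : s ≤ t) : ∫ ω, (W t ω - W s ω) ^ 2 ∂μ = (t : ℝ) - s := by
  have h := (hW.hasLaw_increment hst).variance_eq
  rw [variance_id_gaussianReal, variance_of_integral_eq_zero
    (hW.hasLaw_increment hst).aemeasurable (hW.integral_increment hst)] at h
  rw [h, NNReal.coe_sub hst]

/-- Functions of an increment are uncorrelated with the past. -/
theorem IsBrownianFor.integral_mul_comp_increment (hW : IsBrownianFor 𝓕 W μ) {s t : ℝ≥0}
    (hst : s ≤ t) {η : Ω → ℝ} (hη : Measurable[𝓕 s] η) {φ : ℝ → ℝ} (hφ : Measurable φ) :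
    ∫ ω, η ω * φ (W t ω - W s ω) ∂μ = (∫ ω, η ω ∂μ) * ∫ ω, φ (W t ω - W s ω) ∂μ := by
  have hi : IndepFun η (fun ω => W t ω - W s ω) μ := by
    rw [IndepFun_iff_Indep]
    exact (indep_of_indep_of_le_right (hW.indep_increment s t hst)
      (measurable_iff_comap_le.1 hη)).symm
  have := hi.integral_fun_comp_mul_comp (f := id) (g := φ)
    (hη.mono (𝓕.le s) le_rfl).aemeasurable ((hW.measurable t).sub (hW.measurable s)).aemeasurable
    measurable_id.aestronglyMeasurable hφ.aestronglyMeasurable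
  exact this

theorem IsBrownianFor.integral_mul_increment (hW : IsBrownianFor 𝓕 W μ) {s t : ℝ≥0}
    (hst : s ≤ t) {η : Ω → ℝ} (hη : Measurable[𝓕 s] η) :
    ∫ ω, η ω * (W t ω - W s ω) ∂μ = 0 := by
  have := hW.integral_mul_comp_increment hst hη measurable_id
  simp only [id] at this
  rw [this, hW.integral_increment hst, mul_zero]

theorem memLp_bounded_mul {η X : Ω → ℝ} (hη : Measurable η) (hb : ∃ C : ℝ, ∀ ω, |η ω| ≤ C)
    (hX : MemLp X 2 μ) : MemLp (fun ω => η ω * X ω) 2 μ := by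
  obtain ⟨C, hC⟩ := hb
  exact hX.mul (p := ∞) (q := 2) (memLp_top_of_bound hη.aestronglyMeasurable C
    (Eventually.of_forall hC))

theorem IsBrownianFor.integral_mul_increment_mul_increment (hW : IsBrownianFor 𝓕 W μ)
    {s t t' : ℝ≥0} (hst : s ≤ t) (htt' : t ≤ t') {η : Ω → ℝ} (hη : Measurable[𝓕 s] η)
    (hb : ∃ C : ℝ, ∀ ω, |η ω| ≤ C) :
    ∫ ω, η ω * ((W t ω - W s ω) * (W t' ω - W s ω)) ∂μ = ((t : ℝ) - s) * ∫ ω, η ω ∂μ := by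
  have hm : Measurable η := hη.mono (𝓕.le s) le_rfl
  have h1 := memLp_bounded_mul hm hb (hW.memLp_increment hst)
  have hadapt : Measurable[𝓕 t] fun ω => η ω * (W t ω - W s ω) :=
    (hη.mono (𝓕.mono hst) le_rfl).mul
      ((hW.adapted t).sub ((hW.adapted s).mono (𝓕.mono hst) le_rfl))
  have e : ∀ ω, η ω * ((W t ω - W s ω) * (W t' ω - W s ω)) =
      η ω * (W t ω - W s ω) * (W t ω - W s ω) +
        η ω * (W t ω - W s ω) * (W t' ω - W t ω) := fun ω => by ring
  simp_rw [e]
  rw [integral_add (integrable_fun_mul h1 (hW.memLp_increment hst))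
    (integrable_fun_mul h1 (hW.memLp_increment htt')), hW.integral_mul_increment htt' hadapt, add_zero]
  have e2 : ∀ ω, η ω * (W t ω - W s ω) * (W t ω - W s ω) = η ω * (W t ω - W s ω) ^ 2 :=
    fun ω => by ring
  simp_rw [e2]
  rw [hW.integral_mul_comp_increment hst hη (φ := fun x => x ^ 2) (by fun_prop),
    hW.integral_increment_sq hst, mul_comm]

/-- The case `l ≤ l'` of the covariance of elementary integrals: only the part of the first
increment after `l'` contributes, since the second increment is independent of the past of `l'`
and centred. -/
theorem IsBrownianFor.integral_cross_of_le (hW : IsBrownianFor 𝓕 W μ)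
    {l r l' r' : ℝ≥0} (hlr' : l' ≤ r') (hll' : l ≤ l') {ξ ξ' : Ω → ℝ}
    (hξ : Measurable[𝓕 l] ξ) (hξ' : Measurable[𝓕 l'] ξ')
    (hb : ∃ C : ℝ, ∀ ω, |ξ ω| ≤ C) (hb' : ∃ C : ℝ, ∀ ω, |ξ' ω| ≤ C) :
    ∫ ω, (ξ ω * (W r ω - W l ω)) * (ξ' ω * (W r' ω - W l' ω)) ∂μ =
      max (min (r : ℝ) r' - max (l : ℝ) l') 0 * ∫ ω, ξ ω * ξ' ω ∂μ := by
  have hm : Measurable ξ := hξ.mono (𝓕.le _) le_rfl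
  have hm' : Measurable ξ' := hξ'.mono (𝓕.le _) le_rfl
  have hξl : Measurable[𝓕 l'] ξ := hξ.mono (𝓕.mono hll') le_rfl
  have hll'' : (l : ℝ) ≤ l' := hll'
  have hWm : ∀ t, t ≤ l' → Measurable[𝓕 l'] (W t) :=
    fun t ht => (hW.adapted t).mono (𝓕.mono ht) le_rfl
  rw [max_eq_right hll'']
  rcases le_total r l' with h | h
  · have e : ∀ ω, (ξ ω * (W r ω - W l ω)) * (ξ' ω * (W r' ω - W l' ω)) =
        (ξ ω * (W r ω - W l ω)) * ξ' ω * (W r' ω - W l' ω) := fun ω => by ring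
    simp_rw [e]
    have h' : (r : ℝ) ≤ l' := h
    have hp : Measurable[𝓕 l'] fun ω => ξ ω * (W r ω - W l ω) * ξ' ω :=
      (hξl.mul ((hWm r h).sub (hWm l hll'))).mul hξ'
    rw [hW.integral_mul_increment hlr' hp, max_eq_right, zero_mul]
    linarith [min_le_left (r : ℝ) r']
  · have hbb : ∃ C : ℝ, ∀ ω, |ξ ω * ξ' ω| ≤ C := by
      obtain ⟨C, hC⟩ := hb
      obtain ⟨C', hC'⟩ := hb'
      refine ⟨C * C', fun ω => ?_⟩
      rw [abs_mul]
      exact mul_le_mul (hC ω) (hC' ω) (abs_nonneg _) ((abs_nonneg _).trans (hC ω))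
    have hp : Measurable[𝓕 l'] fun ω => ξ ω * ξ' ω := hξl.mul hξ'
    have e : ∀ ω, (ξ ω * (W r ω - W l ω)) * (ξ' ω * (W r' ω - W l' ω)) =
        (ξ ω * ξ' ω) * (W l' ω - W l ω) * (W r' ω - W l' ω) +
        (ξ ω * ξ' ω) * ((W r ω - W l' ω) * (W r' ω - W l' ω)) := fun ω => by ring
    simp_rw [e]
    have hmm : Measurable fun ω => ξ ω * ξ' ω := hm.mul hm'
    have hd := memLp_bounded_mul hmm hbb (hW.memLp_increment hll')
    have hd' := memLp_bounded_mul hmm hbb (hW.memLp_increment h)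
    have hq : Measurable[𝓕 l'] fun ω => ξ ω * ξ' ω * (W l' ω - W l ω) :=
      hp.mul ((hWm l' le_rfl).sub (hWm l hll'))
    have hi : Integrable (fun ω => (ξ ω * ξ' ω) * ((W r ω - W l' ω) * (W r' ω - W l' ω))) μ := by
      refine (hd'.integrable_mul (hW.memLp_increment hlr')).congr (Eventually.of_forall fun ω => ?_)
      simp [mul_assoc]
    rw [integral_add (integrable_fun_mul hd (hW.memLp_increment hlr')) hi,
      hW.integral_mul_increment hlr' hq, zero_add]
    have h0 : (l' : ℝ) ≤ r := h
    have h0' : (l' : ℝ) ≤ r' := hlr'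
    rw [max_eq_left (sub_nonneg.2 (le_min h0 h0'))]
    rcases le_total r r' with h1 | h1
    · rw [hW.integral_mul_increment_mul_increment h h1 hp hbb, min_eq_left (by exact_mod_cast h1)]
    · rw [min_eq_right (by exact_mod_cast h1),
        ← hW.integral_mul_increment_mul_increment hlr' h1 hp hbb]
      congr with ω
      ring

/-- The covariance of two elementary integrals `ξ (W r - W l)` and `ξ' (W r' - W l')`; the factor
in front is the length of `(l, r] ∩ (l', r']`. -/
theorem IsBrownianFor.integral_cross (hW : IsBrownianFor 𝓕 W μ)
    {l r l' r' : ℝ≥0} (hlr : l ≤ r) (hlr' : l' ≤ r') {ξ ξ' : Ω → ℝ}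
    (hξ : Measurable[𝓕 l] ξ) (hξ' : Measurable[𝓕 l'] ξ')
    (hb : ∃ C : ℝ, ∀ ω, |ξ ω| ≤ C) (hb' : ∃ C : ℝ, ∀ ω, |ξ' ω| ≤ C) :
    ∫ ω, (ξ ω * (W r ω - W l ω)) * (ξ' ω * (W r' ω - W l' ω)) ∂μ =
      max (min (r : ℝ) r' - max (l : ℝ) l') 0 * ∫ ω, ξ ω * ξ' ω ∂μ := by
  rcases le_total l l' with h | h
  · exact hW.integral_cross_of_le hlr' h hξ hξ' hb hb'
  · have := hW.integral_cross_of_le (r := r') hlr h hξ' hξ hb' hb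
    rw [min_comm, max_comm (l' : ℝ)] at this
    simp_rw [mul_comm (ξ' _) (ξ _)] at this
    rw [← this]
    congr with ω
    ring

end Increments

/-! ### The isometry for simple processes -/

section Isometry

variable {Ω : Type*} {m : MeasurableSpace Ω} {μ : Measure Ω}
  {𝓕 : Filtration ℝ≥0 m} {W : ℝ≥0 → Ω → ℝ} {T : ℝ}

theorem SimpleProcess.memLp_integral (H : SimpleProcess 𝓕 T) (hW : IsBrownianFor 𝓕 W μ) :
    MemLp (H.integral W) 2 μ := by
  refine memLp_finsetSum _ fun i _ => ?_
  exact memLp_bounded_mul ((H.measurable_ξ i).mono (𝓕.le _) le_rfl) (H.bounded_ξ i)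
    (hW.memLp_increment (H.left_le_right i))

variable [IsProbabilityMeasure μ]

theorem SimpleProcess.memLp_summand (H : SimpleProcess 𝓕 T) (i : Fin H.n) :
    MemLp (fun p : ℝ × Ω => (Set.Ioc (H.left i : ℝ) (H.right i : ℝ)).indicator
      (fun _ => H.ξ i p.2) p.1) 2 ((volume.restrict (Set.Icc 0 T)).prod μ) := by
  obtain ⟨C, hC⟩ := H.bounded_ξ i
  have hm : Measurable (H.ξ i) := (H.measurable_ξ i).mono (𝓕.le _) le_rfl
  refine MemLp.of_bound (C := C) ?_ (Eventually.of_forall fun p => ?_)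
  · have : (fun p : ℝ × Ω => (Set.Ioc (H.left i : ℝ) (H.right i : ℝ)).indicator
      (fun _ => H.ξ i p.2) p.1) =
        (Prod.fst ⁻¹' Set.Ioc (H.left i : ℝ) (H.right i : ℝ)).indicator
          (fun p : ℝ × Ω => H.ξ i p.2) := by
      ext p; simp [Set.indicator]
    rw [this]
    exact ((hm.comp measurable_snd).indicator
      (measurable_fst measurableSet_Ioc)).aestronglyMeasurable
  · by_cases hp : p.1 ∈ Set.Ioc (H.left i : ℝ) (H.right i : ℝ)
    · simpa [Set.indicator_of_mem hp] using hC p.2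
    · simpa [Set.indicator_of_notMem hp] using (abs_nonneg _).trans (hC p.2)

theorem SimpleProcess.memLp_eval (H : SimpleProcess 𝓕 T) :
    MemLp (fun p : ℝ × Ω => H.eval p.1 p.2) 2 ((volume.restrict (Set.Icc 0 T)).prod μ) :=
  memLp_finsetSum _ fun i _ => H.memLp_summand i

/-- The Itô isometry for simple processes, in bilinear form. -/
theorem SimpleProcess.integral_mul_integral (H K : SimpleProcess 𝓕 T)
    (hW : IsBrownianFor 𝓕 W μ) :
    ∫ ω, H.integral W ω * K.integral W ω ∂μ =
      ∫ p, H.eval p.1 p.2 * K.eval p.1 p.2 ∂((volume.restrict (Set.Icc 0 T)).prod μ) := by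
  simp only [SimpleProcess.integral, SimpleProcess.eval, Finset.sum_mul_sum]
  have hI : ∀ (L : SimpleProcess 𝓕 T) (i : Fin L.n),
      MemLp (fun ω => L.ξ i ω * (W (L.right i) ω - W (L.left i) ω)) 2 μ := fun L i =>
    memLp_bounded_mul ((L.measurable_ξ i).mono (𝓕.le _) le_rfl) (L.bounded_ξ i)
      (hW.memLp_increment (L.left_le_right i))
  rw [integral_finsetSum _ fun i _ => integrable_finsetSum _ fun j _ =>
      integrable_fun_mul (hI H i) (hI K j),
    integral_finsetSum _ fun i _ => integrable_finsetSum _ fun j _ =>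
      integrable_fun_mul (H.memLp_summand i) (K.memLp_summand j)]
  refine Finset.sum_congr rfl fun i _ => ?_
  rw [integral_finsetSum _ fun j _ => integrable_fun_mul (hI H i) (hI K j),
    integral_finsetSum _ fun j _ => integrable_fun_mul (H.memLp_summand i) (K.memLp_summand j)]
  refine Finset.sum_congr rfl fun j _ => ?_
  rw [hW.integral_cross (H.left_le_right i) (K.left_le_right j) (H.measurable_ξ i)
    (K.measurable_ξ j) (H.bounded_ξ i) (K.bounded_ξ j)]
  have e : ∀ p : ℝ × Ω,
      (Set.Ioc (H.left i : ℝ) (H.right i : ℝ)).indicator (fun _ => H.ξ i p.2) p.1 *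
        (Set.Ioc (K.left j : ℝ) (K.right j : ℝ)).indicator (fun _ => K.ξ j p.2) p.1 =
      (Set.Ioc (max (H.left i : ℝ) (K.left j)) (min (H.right i : ℝ) (K.right j))).indicator
        (fun _ => (1 : ℝ)) p.1 * (H.ξ i p.2 * K.ξ j p.2) := fun p => by
    rw [← Set.Ioc_inter_Ioc]
    by_cases h1 : p.1 ∈ Set.Ioc (H.left i : ℝ) (H.right i : ℝ) <;>
      by_cases h2 : p.1 ∈ Set.Ioc (K.left j : ℝ) (K.right j : ℝ) <;>
      simp [Set.indicator, h1, h2]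
  simp_rw [e]
  rw [integral_prod_mul (fun t => (Set.Ioc (max (H.left i : ℝ) (K.left j))
      (min (H.right i : ℝ) (K.right j))).indicator (fun _ => (1 : ℝ)) t)
      (fun ω => H.ξ i ω * K.ξ j ω), integral_indicator_const _ measurableSet_Ioc,
    measureReal_restrict_apply measurableSet_Ioc, Set.inter_eq_left.2]
  · simp [Measure.real, Real.volume_Ioc, ENNReal.toReal_ofReal']
  · intro s hs
    exact ⟨(((H.left i).coe_nonneg.trans (le_max_left _ _)).trans_lt hs.1).le,
      hs.2.trans ((min_le_left _ _).trans (H.right_le i))⟩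

end Isometry

/-! ### Inner products in `L²` -/

section L2

variable {α : Type*} {mα : MeasurableSpace α} {ν : Measure α}

theorem inner_toLp_eq_integral {f g : α → ℝ} (hf : MemLp f 2 ν) (hg : MemLp g 2 ν) :
    inner ℝ (hf.toLp f) (hg.toLp g) = ∫ x, f x * g x ∂ν := by
  rw [L2.inner_def]
  refine integral_congr_ae ?_
  filter_upwards [hf.coeFn_toLp, hg.coeFn_toLp] with x h1 h2
  rw [h1, h2]
  simp [mul_comm]

theorem tendsto_integral_mul_of_tendsto_eLpNorm {F G : ℕ → α → ℝ} {f g : α → ℝ}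
    (hF : ∀ k, MemLp (F k) 2 ν) (hG : ∀ k, MemLp (G k) 2 ν) (hf : MemLp f 2 ν) (hg : MemLp g 2 ν)
    (hFf : Tendsto (fun k => eLpNorm (fun x => F k x - f x) 2 ν) atTop (𝓝 0))
    (hGg : Tendsto (fun k => eLpNorm (fun x => G k x - g x) 2 ν) atTop (𝓝 0)) :
    Tendsto (fun k => ∫ x, F k x * G k x ∂ν) atTop (𝓝 (∫ x, f x * g x ∂ν)) := by
  have h1 := (Lp.tendsto_Lp_iff_tendsto_eLpNorm'' F hF f hf).2 hFf
  have h2 := (Lp.tendsto_Lp_iff_tendsto_eLpNorm'' G hG g hg).2 hGg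
  simpa only [inner_toLp_eq_integral] using Filter.Tendsto.inner (𝕜 := ℝ) h1 h2

theorem integral_sub_linearCombination_sq {X Y Z : α → ℝ} (hX : MemLp X 2 ν) (hY : MemLp Y 2 ν)
    (hZ : MemLp Z 2 ν) (a b : ℝ) :
    ∫ x, (Z x - (a * X x + b * Y x)) ^ 2 ∂ν =
      (∫ x, Z x * Z x ∂ν) - 2 * a * (∫ x, Z x * X x ∂ν) - 2 * b * (∫ x, Z x * Y x ∂ν) +
        a ^ 2 * (∫ x, X x * X x ∂ν) + 2 * a * b * (∫ x, X x * Y x ∂ν) +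
        b ^ 2 * (∫ x, Y x * Y x ∂ν) := by
  have hW : MemLp (fun x => Z x - (a * X x + b * Y x)) 2 ν :=
    hZ.sub ((hX.const_mul a).add (hY.const_mul b))
  have e : hW.toLp = hZ.toLp - (a • hX.toLp + b • hY.toLp) := rfl
  have h := inner_toLp_eq_integral hW hW
  rw [e] at h
  simp only [pow_two]
  rw [← h, ← inner_toLp_eq_integral hZ hZ, ← inner_toLp_eq_integral hZ hX,
    ← inner_toLp_eq_integral hZ hY, ← inner_toLp_eq_integral hX hX,
    ← inner_toLp_eq_integral hX hY, ← inner_toLp_eq_integral hY hY]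
  simp only [inner_sub_left, inner_sub_right, inner_add_left, inner_add_right,
    real_inner_smul_left, real_inner_smul_right]
  rw [real_inner_comm (hZ.toLp) (hX.toLp), real_inner_comm (hZ.toLp) (hY.toLp),
    real_inner_comm (hX.toLp) (hY.toLp)]
  ring

end L2

/-! ### Isometry, linearity and convergence of the Itô integral -/

section Ito

variable {Ω : Type*} {m : MeasurableSpace Ω} {μ : Measure Ω} [IsProbabilityMeasure μ]
  {𝓕 : Filtration ℝ≥0 m} {W : ℝ≥0 → Ω → ℝ} {T : ℝ}

/-- The Itô isometry, in bilinear form. -/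
theorem IsItoIntegral.integral_mul (hW : IsBrownianFor 𝓕 W μ) {u v : ℝ → Ω → ℝ} {X Y : Ω → ℝ}
    (hX : IsItoIntegral 𝓕 W μ T u X) (hY : IsItoIntegral 𝓕 W μ T v Y) :
    ∫ ω, X ω * Y ω ∂μ =
      ∫ p, u p.1 p.2 * v p.1 p.2 ∂((volume.restrict (Set.Icc 0 T)).prod μ) := by
  obtain ⟨hu, hX2, H, hHu, hHX⟩ := hX
  obtain ⟨hv, hY2, K, hKv, hKY⟩ := hY
  refine tendsto_nhds_unique (tendsto_integral_mul_of_tendsto_eLpNorm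
    (fun k => (H k).memLp_integral hW) (fun k => (K k).memLp_integral hW) hX2 hY2 hHX hKY) ?_
  simp_rw [fun k => (H k).integral_mul_integral (K k) hW]
  exact tendsto_integral_mul_of_tendsto_eLpNorm
    (fun k => (H k).memLp_eval) (fun k => (K k).memLp_eval) hu hv hHu hKv

/-- Since the isometry determines all inner products, Itô integration is linear. -/
theorem IsItoIntegral.ae_eq_linearCombination (hW : IsBrownianFor 𝓕 W μ) {u v w : ℝ → Ω → ℝ}
    {X Y Z : Ω → ℝ} {a b : ℝ} (hX : IsItoIntegral 𝓕 W μ T u X) (hY : IsItoIntegral 𝓕 W μ T v Y)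
    (hZ : IsItoIntegral 𝓕 W μ T w Z)
    (hw : ∀ᵐ p ∂((volume.restrict (Set.Icc 0 T)).prod μ),
      w p.1 p.2 = a * u p.1 p.2 + b * v p.1 p.2) :
    Z =ᵐ[μ] fun ω => a * X ω + b * Y ω := by
  have h0 : ∫ ω, (Z ω - (a * X ω + b * Y ω)) ^ 2 ∂μ = 0 := by
    rw [integral_sub_linearCombination_sq hX.2.1 hY.2.1 hZ.2.1, hZ.integral_mul hW hZ,
      hZ.integral_mul hW hX, hZ.integral_mul hW hY, hX.integral_mul hW hX, hX.integral_mul hW hY,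
      hY.integral_mul hW hY, ← integral_sub_linearCombination_sq hX.1 hY.1 hZ.1]
    refine integral_eq_zero_of_ae ?_
    filter_upwards [hw] with p hp
    simp [hp]
  have hi : MemLp (fun ω => Z ω - (a * X ω + b * Y ω)) 2 μ :=
    hZ.2.1.sub ((hX.2.1.const_mul a).add (hY.2.1.const_mul b))
  rw [integral_eq_zero_iff_of_nonneg (fun ω => sq_nonneg _) hi.integrable_sq] at h0
  filter_upwards [h0] with ω h
  simpa [sub_eq_zero] using h

theorem IsItoIntegral.ae_eq (hW : IsBrownianFor 𝓕 W μ) {u : ℝ → Ω → ℝ} {X Y : Ω → ℝ}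
    (hX : IsItoIntegral 𝓕 W μ T u X) (hY : IsItoIntegral 𝓕 W μ T u Y) : X =ᵐ[μ] Y := by
  simpa using hY.ae_eq_linearCombination (a := 1) (b := 0) hW hY hX
    (Eventually.of_forall fun p => by simp)

/-- By the isometry and completeness of `L²`, elementary integrals converge as soon as the simple
integrands do. -/
theorem exists_tendsto_integral_of_tendsto_eval (hW : IsBrownianFor 𝓕 W μ) {u : ℝ → Ω → ℝ}
    (hu : MemLp (fun p : ℝ × Ω => u p.1 p.2) 2 ((volume.restrict (Set.Icc 0 T)).prod μ))
    {H : ℕ → SimpleProcess 𝓕 T}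
    (hH : Tendsto (fun k => eLpNorm (fun p : ℝ × Ω => (H k).eval p.1 p.2 - u p.1 p.2) 2
      ((volume.restrict (Set.Icc 0 T)).prod μ)) atTop (𝓝 0)) :
    ∃ X, MemLp X 2 μ ∧
      Tendsto (fun k => eLpNorm (fun ω => (H k).integral W ω - X ω) 2 μ) atTop (𝓝 0) := by
  set I : ℕ → Lp ℝ 2 μ := fun k => ((H k).memLp_integral hW).toLp
  set E : ℕ → Lp ℝ 2 ((volume.restrict (Set.Icc 0 T)).prod μ) := fun k => (H k).memLp_eval.toLp
  have hE : Tendsto E atTop (𝓝 hu.toLp) :=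
    (Lp.tendsto_Lp_iff_tendsto_eLpNorm'' _ (fun k => (H k).memLp_eval) _ hu).2 hH
  -- both sequences have the same Gram matrix, hence the same mutual distances
  have hin : ∀ j k, inner ℝ (I j) (I k) = inner ℝ (E j) (E k) := fun j k => by
    rw [inner_toLp_eq_integral, inner_toLp_eq_integral, (H j).integral_mul_integral (H k) hW]
  have hd : ∀ j k, dist (I j) (I k) = dist (E j) (E k) := fun j k => by
    rw [dist_eq_norm, dist_eq_norm, ← sq_eq_sq₀ (norm_nonneg _) (norm_nonneg _),
      ← real_inner_self_eq_norm_sq, ← real_inner_self_eq_norm_sq]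
    simp only [inner_sub_left, inner_sub_right, hin]
  have hc : CauchySeq I := by
    have := hE.cauchySeq
    rw [Metric.cauchySeq_iff] at this ⊢
    simpa only [hd] using this
  obtain ⟨Y, hY⟩ := cauchySeq_tendsto_of_complete hc
  refine ⟨Y, Lp.memLp Y, (Lp.tendsto_Lp_iff_tendsto_eLpNorm'' _
    (fun k => (H k).memLp_integral hW) _ (Lp.memLp Y)).1 ?_⟩
  rwa [Lp.toLp_coeFn]

end Ito

/-! ### Itô integrals of deterministic functions -/

section Wiener

variable {Ω : Type*} {m : MeasurableSpace Ω} {μ : Measure Ω}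
  {𝓕 : Filtration ℝ≥0 m} {W : ℝ≥0 → Ω → ℝ} {T : ℝ}

/-- A simple process whose coefficients are constants. -/
def SimpleProcess.IsDeterministic (H : SimpleProcess 𝓕 T) : Prop :=
  ∃ c : Fin H.n → ℝ, ∀ i ω, H.ξ i ω = c i

/-- The step process equal to `g (i T / N)` on `(i T / N, (i + 1) T / N]` for `i < N`. -/
noncomputable def stepProcess (𝓕 : Filtration ℝ≥0 m) (T : ℝ≥0) (g : ℝ → ℝ) (N : ℕ) :
    SimpleProcess 𝓕 T where
  n := N
  left i := (i : ℕ) * (T / N)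
  right i := ((i : ℕ) + 1) * (T / N)
  left_le_right i := by gcongr; exact le_self_add
  right_le i := by
    have hN : (0 : ℝ≥0) < N := by exact_mod_cast i.pos
    have h : ((i : ℕ) + 1 : ℝ≥0) ≤ N := by exact_mod_cast i.2
    have : ((i : ℕ) + 1 : ℝ≥0) * (T / N) ≤ T :=
      calc ((i : ℕ) + 1 : ℝ≥0) * (T / N) ≤ N * (T / N) := by gcongr
        _ = T := mul_div_cancel₀ _ hN.ne'
    exact_mod_cast this
  ξ i _ := g ((i : ℕ) * ((T : ℝ) / N))
  measurable_ξ _ := measurable_const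
  bounded_ξ i := ⟨_, fun _ => le_rfl⟩

theorem stepProcess_isDeterministic (T : ℝ≥0) (g : ℝ → ℝ) (N : ℕ) :
    (stepProcess 𝓕 T g N).IsDeterministic := ⟨_, fun _ _ => rfl⟩

theorem abs_stepProcess_eval_sub_le {T : ℝ≥0} {g : ℝ → ℝ} {N : ℕ} {δ ε : ℝ}
    (hN : T < N * δ)
    (hg : ∀ s ∈ Set.Icc (0 : ℝ) T, ∀ t ∈ Set.Icc (0 : ℝ) T, |s - t| < δ → |g s - g t| < ε)
    {t : ℝ} (ht : t ∈ Set.Ioc (0 : ℝ) T) (ω : Ω) :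
    |(stepProcess 𝓕 T g N).eval t ω - g t| ≤ ε := by
  have hT : 0 < (T : ℝ) := ht.1.trans_le ht.2
  have hN0 : N ≠ 0 := by
    rintro rfl
    simp at hN
  have hNp : 0 < (N : ℝ) := by positivity
  set d : ℝ := (T : ℝ) / N with hd
  have hdp : 0 < d := by positivity
  have hNd : N * d = T := by rw [hd]; field_simp
  have hdδ : d < δ := by rw [hd, div_lt_iff₀ hNp]; linarith
  -- the interval containing `t` is the one with index `⌈t / d⌉ - 1`
  set q : ℕ := ⌈t / d⌉₊ with hq
  have hq0 : 0 < q := Nat.ceil_pos.2 (div_pos ht.1 hdp)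
  have hqN : q ≤ N := by
    refine Nat.ceil_le.2 ?_
    rw [div_le_iff₀ hdp, hNd]
    exact ht.2
  have hq1 : t ≤ q * d := (div_le_iff₀ hdp).1 (Nat.le_ceil _)
  have hq2 : ((q : ℝ) - 1) * d < t := by
    have := Nat.ceil_lt_add_one (div_pos ht.1 hdp).le
    rw [← hq] at this
    rw [← lt_div_iff₀ hdp]
    linarith
  obtain ⟨r, hr⟩ : ∃ r, q = r + 1 := ⟨q - 1, by omega⟩
  have hrN : r < N := by omega
  rw [hr] at hq1 hq2
  push_cast at hq1 hq2
  have hev : (stepProcess 𝓕 T g N).eval t ω = g (r * d) := by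
    have hsum : (stepProcess 𝓕 T g N).eval t ω = ∑ i : Fin N,
        (Set.Ioc ((i : ℕ) * d) (((i : ℕ) + 1) * d)).indicator (fun _ => g ((i : ℕ) * d)) t := by
      simp only [SimpleProcess.eval, stepProcess]
      refine Finset.sum_congr rfl fun i _ => ?_
      push_cast
      rfl
    rw [hsum, Finset.sum_eq_single (⟨r, hrN⟩ : Fin N)]
    · rw [Set.indicator_of_mem]
      exact ⟨by linarith, hq1⟩
    · intro i _ hi
      rw [Set.indicator_of_notMem]
      rintro ⟨h1, h2⟩
      apply hi
      ext
      simp only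
      have h3 : ((i : ℕ) : ℝ) < r + 1 := lt_of_mul_lt_mul_right (h1.trans_le hq1) hdp.le
      have h4 : (r : ℝ) < (i : ℕ) + 1 := by
        refine lt_of_mul_lt_mul_right (lt_of_lt_of_le ?_ h2) hdp.le
        linarith
      have h3' : (i : ℕ) < r + 1 := by exact_mod_cast h3
      have h4' : r < (i : ℕ) + 1 := by exact_mod_cast h4
      omega
    · intro h
      exact absurd (Finset.mem_univ _) h
  rw [hev]
  refine (hg _ ⟨by positivity, by linarith [ht.2]⟩ t ⟨ht.1.le, ht.2⟩ ?_).le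
  rw [abs_sub_lt_iff]
  constructor <;> linarith

theorem eLpNorm_comp_fst [IsProbabilityMeasure μ] {ν : Measure ℝ} [SFinite ν] {f : ℝ → ℝ}
    (hf : AEStronglyMeasurable f ν) :
    eLpNorm (fun p : ℝ × Ω => f p.1) 2 (ν.prod μ) = eLpNorm f 2 ν :=
  eLpNorm_comp_measurePreserving (f := Prod.fst) hf measurePreserving_fst

theorem memLp_comp_fst [IsProbabilityMeasure μ] {ν : Measure ℝ} [SFinite ν] {f : ℝ → ℝ}
    (hf : MemLp f 2 ν) : MemLp (fun p : ℝ × Ω => f p.1) 2 (ν.prod μ) :=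
  hf.comp_measurePreserving (f := Prod.fst) measurePreserving_fst

theorem exists_stepProcess_eLpNorm_sub_le [IsProbabilityMeasure μ] (hT : 0 ≤ T) {f : ℝ → ℝ}
    (hf : MemLp f 2 (volume.restrict (Set.Icc 0 T))) {ε : ℝ≥0∞} (hε : ε ≠ 0) :
    ∃ H : SimpleProcess 𝓕 T, H.IsDeterministic ∧
      eLpNorm (fun p : ℝ × Ω => H.eval p.1 p.2 - f p.1) 2
        ((volume.restrict (Set.Icc 0 T)).prod μ) ≤ ε := by
  lift T to ℝ≥0 using hT
  have hε2 : ε / 2 ≠ 0 := by simpa using hε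
  obtain ⟨g, hfg, hg2⟩ := hf.exists_boundedContinuous_eLpNorm_sub_le (by simp) hε2
  obtain ⟨e, he0, he⟩ : ∃ e : ℝ, 0 < e ∧
      (((volume.restrict (Set.Icc (0 : ℝ) T)).prod μ) Set.univ) ^ (2 : ℝ≥0∞).toReal⁻¹ *
        ENNReal.ofReal e ≤ ε / 2 := by
    have hlim : Tendsto (fun e : ℝ =>
        (((volume.restrict (Set.Icc (0 : ℝ) T)).prod μ) Set.univ) ^ (2 : ℝ≥0∞).toReal⁻¹ *
        ENNReal.ofReal e) (𝓝[>] 0) (𝓝 0) := by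
      have h1 : Tendsto (fun e : ℝ => ENNReal.ofReal e) (𝓝[>] 0) (𝓝 0) := by
        have := ENNReal.tendsto_ofReal (tendsto_id (α := ℝ) (x := 𝓝 0))
        simp only [ENNReal.ofReal_zero] at this
        exact this.mono_left nhdsWithin_le_nhds
      have h2 := ENNReal.Tendsto.const_mul (a :=
        (((volume.restrict (Set.Icc (0 : ℝ) T)).prod μ) Set.univ) ^ (2 : ℝ≥0∞).toReal⁻¹) h1
        (Or.inr (ENNReal.rpow_ne_top_of_nonneg (by simp) (measure_ne_top _ _)))
      simpa using h2
    have hev := hlim.eventually (eventually_le_nhds (pos_iff_ne_zero.2 hε2))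
    obtain ⟨e, h1, h2⟩ := (hev.and self_mem_nhdsWithin).exists
    exact ⟨e, h2, h1⟩
  have huc : UniformContinuousOn g (Set.Icc (0 : ℝ) T) :=
    isCompact_Icc.uniformContinuousOn_of_continuous g.continuous.continuousOn
  rw [Metric.uniformContinuousOn_iff] at huc
  obtain ⟨δ, hδ0, hδ⟩ := huc e he0
  obtain ⟨N, hN⟩ := exists_nat_gt ((T : ℝ) / δ)
  rw [div_lt_iff₀ hδ0] at hN
  refine ⟨stepProcess 𝓕 T g N, stepProcess_isDeterministic T g N, ?_⟩
  have hb : eLpNorm (fun p : ℝ × Ω => (stepProcess 𝓕 T g N).eval p.1 p.2 - g p.1) 2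
      ((volume.restrict (Set.Icc (0 : ℝ) T)).prod μ) ≤ ε / 2 := by
    refine (eLpNorm_le_of_ae_bound (C := e) ?_).trans he
    -- the steps leave out `t = 0`, a null set
    have hpos : ∀ᵐ t ∂(volume.restrict (Set.Icc (0 : ℝ) T)), t ∈ Set.Ioc (0 : ℝ) T := by
      rw [← restrict_Ioc_eq_restrict_Icc]
      exact ae_restrict_mem measurableSet_Ioc
    filter_upwards [(Measure.quasiMeasurePreserving_fst (ν := μ)).ae hpos] with p hp
    exact abs_stepProcess_eval_sub_le hN hδ hp p.2
  have hgf : eLpNorm (fun p : ℝ × Ω => g p.1 - f p.1) 2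
      ((volume.restrict (Set.Icc (0 : ℝ) T)).prod μ) ≤ ε / 2 := by
    rw [eLpNorm_comp_fst (f := fun t => g t - f t) (hg2.sub hf).aestronglyMeasurable]
    rw [← eLpNorm_neg] at hfg
    have e : (fun t => g t - f t) = -(f - ⇑g) := by ext; simp
    rwa [e]
  calc _ = eLpNorm ((fun p : ℝ × Ω => (stepProcess 𝓕 T g N).eval p.1 p.2 - g p.1) +
        fun p : ℝ × Ω => g p.1 - f p.1) 2 ((volume.restrict (Set.Icc (0 : ℝ) T)).prod μ) := by
        congr 1; ext p; simp
    _ ≤ ε / 2 + ε / 2 := by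
        refine (eLpNorm_add_le ?_ ?_ (by simp)).trans (add_le_add hb hgf)
        · exact ((stepProcess 𝓕 T g N).memLp_eval.sub (memLp_comp_fst hg2)).aestronglyMeasurable
        · exact ((memLp_comp_fst hg2).sub (memLp_comp_fst hf)).aestronglyMeasurable
    _ = ε := ENNReal.add_halves ε

/-- A deterministic square-integrable integrand has an Itô integral, and the approximating simple
processes can be taken deterministic too. -/
theorem exists_isItoIntegral_deterministic [IsProbabilityMeasure μ] (hW : IsBrownianFor 𝓕 W μ)
    (hT : 0 ≤ T) {f : ℝ → ℝ} (hf : MemLp f 2 (volume.restrict (Set.Icc 0 T))) :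
    ∃ X, IsItoIntegral 𝓕 W μ T (fun t _ => f t) X ∧ ∃ H : ℕ → SimpleProcess 𝓕 T,
      (∀ k, (H k).IsDeterministic) ∧
      Tendsto (fun k => eLpNorm (fun p : ℝ × Ω => (H k).eval p.1 p.2 - f p.1) 2
        ((volume.restrict (Set.Icc 0 T)).prod μ)) atTop (𝓝 0) ∧
      Tendsto (fun k => eLpNorm (fun ω => (H k).integral W ω - X ω) 2 μ) atTop (𝓝 0) := by
  obtain ⟨u, -, hu0, hu⟩ := exists_seq_strictAnti_tendsto' (α := ℝ≥0∞) zero_lt_one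
  choose H hd hH using fun k =>
    exists_stepProcess_eLpNorm_sub_le (μ := μ) (𝓕 := 𝓕) hT hf (hu0 k).1.ne'
  have hlim := tendsto_of_tendsto_of_tendsto_of_le_of_le tendsto_const_nhds hu
    (fun k => zero_le (a := _)) hH
  have hf' : MemLp (fun p : ℝ × Ω => f p.1) 2 ((volume.restrict (Set.Icc 0 T)).prod μ) :=
    memLp_comp_fst hf
  obtain ⟨X, hX2, hX⟩ := exists_tendsto_integral_of_tendsto_eval (u := fun t _ => f t) hW hf' hlim
  exact ⟨X, ⟨hf', hX2, H, hlim, hX⟩, H, hd, hlim, hX⟩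

theorem itoIntegral_spec {u : ℝ → Ω → ℝ} (h : ∃ X, IsItoIntegral 𝓕 W μ T u X) :
    IsItoIntegral 𝓕 W μ T u (itoIntegral 𝓕 W μ T u) := by
  rw [itoIntegral, dif_pos h]
  exact Classical.choose_spec h

theorem isItoIntegral_itoIntegral_deterministic [IsProbabilityMeasure μ]
    (hW : IsBrownianFor 𝓕 W μ) (hT : 0 ≤ T) {f : ℝ → ℝ}
    (hf : MemLp f 2 (volume.restrict (Set.Icc 0 T))) :
    IsItoIntegral 𝓕 W μ T (fun t _ => f t) (itoIntegral 𝓕 W μ T fun t _ => f t) :=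
  itoIntegral_spec ((exists_isItoIntegral_deterministic hW hT hf).imp fun _ h => h.1)

theorem SimpleProcess.IsDeterministic.hasGaussianLaw_integral {H : SimpleProcess 𝓕 T}
    (hH : H.IsDeterministic) (hW : IsBrownianFor 𝓕 W μ) : HasGaussianLaw (H.integral W) μ := by
  obtain ⟨c, hc⟩ := hH
  have hG : IsGaussianProcess
      (fun (i : Fin H.n) ω => c i * (W (H.right i) ω - W (H.left i) ω)) μ := by
    classical
    refine hW.toIsPreBrownianReal.isGaussianProcess.of_isGaussianProcess fun i =>
      ⟨{H.left i, H.right i},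
        c i • (ContinuousLinearMap.proj ⟨H.right i, by simp⟩ -
          ContinuousLinearMap.proj ⟨H.left i, by simp⟩), fun ω => ?_⟩
    simp [Finset.restrict_def]
  have e : H.integral W = fun ω => ∑ i, c i * (W (H.right i) ω - W (H.left i) ω) := by
    ext ω
    simp [SimpleProcess.integral, hc]
  rw [e]
  exact hG.hasGaussianLaw_fun_sum (I := Finset.univ)

theorem SimpleProcess.IsDeterministic.integral_integral {H : SimpleProcess 𝓕 T}
    (hH : H.IsDeterministic) (hW : IsBrownianFor 𝓕 W μ) [IsProbabilityMeasure μ] :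
    ∫ ω, H.integral W ω ∂μ = 0 := by
  obtain ⟨c, hc⟩ := hH
  simp only [SimpleProcess.integral, hc]
  rw [integral_finsetSum _ fun i _ =>
    ((hW.memLp_increment (H.left_le_right i)).integrable (by simp)).const_mul _]
  simp [integral_const_mul, hW.integral_increment (H.left_le_right _)]

theorem SimpleProcess.IsDeterministic.charFun_map_integral {H : SimpleProcess 𝓕 T}
    (hH : H.IsDeterministic) (hW : IsBrownianFor 𝓕 W μ) [IsProbabilityMeasure μ] (t : ℝ) :
    charFun (μ.map (H.integral W)) t =
      Complex.exp (-((∫ ω, H.integral W ω * H.integral W ω ∂μ : ℝ) : ℂ) * t ^ 2 / 2) := by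
  have hG := hH.hasGaussianLaw_integral hW
  have h0 := hH.integral_integral hW
  rw [hG.map_eq_gaussianReal, charFun_gaussianReal, h0,
    variance_of_integral_eq_zero hG.aemeasurable h0,
    Real.coe_toNNReal _ (integral_nonneg fun ω => sq_nonneg _)]
  simp [pow_two, neg_div]

theorem _root_.MeasureTheory.TendstoInMeasure.tendsto_charFun_map [IsProbabilityMeasure μ]
    {X : ℕ → Ω → ℝ} {Y : Ω → ℝ} (h : TendstoInMeasure μ X atTop Y)
    (hX : ∀ k, AEMeasurable (X k) μ) (t : ℝ) :
    Tendsto (fun k => charFun (μ.map (X k)) t) atTop (𝓝 (charFun (μ.map Y) t)) :=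
  ProbabilityMeasure.tendsto_iff_tendsto_charFun.1 (h.tendstoInDistribution hX).tendsto t

/-- The Itô integral of a deterministic `f` has law `N(0, ∫ f²)`: it is a limit of linear
combinations of values of the Gaussian process `W`. -/
theorem IsItoIntegral.hasLaw_gaussianReal [IsProbabilityMeasure μ] (hW : IsBrownianFor 𝓕 W μ)
    (hT : 0 ≤ T) {f : ℝ → ℝ} {X : Ω → ℝ} (hX : IsItoIntegral 𝓕 W μ T (fun t _ => f t) X)
    (hf : MemLp f 2 (volume.restrict (Set.Icc 0 T))) :
    HasLaw X (gaussianReal 0 (∫ t in Set.Icc 0 T, f t ^ 2).toNNReal) μ := by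
  obtain ⟨Y, hY, H, hd, -, hHY⟩ := exists_isItoIntegral_deterministic hW hT hf
  refine HasLaw.congr ?_ (hX.ae_eq hW hY)
  refine ⟨hY.2.1.aemeasurable, ?_⟩
  have hYm := Measure.isProbabilityMeasure_map (μ := μ) hY.2.1.aemeasurable
  refine Measure.ext_of_charFun (funext fun t => ?_)
  have hm : TendstoInMeasure μ (fun k => (H k).integral W) atTop Y :=
    tendstoInMeasure_of_tendsto_eLpNorm (by simp)
      (fun k => ((H k).memLp_integral hW).aestronglyMeasurable) hY.2.1.aestronglyMeasurable hHY
  refine tendsto_nhds_unique (hm.tendsto_charFun_map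
    (fun k => ((H k).memLp_integral hW).aemeasurable) t) ?_
  simp_rw [fun k => (hd k).charFun_map_integral hW t]
  have hv := tendsto_integral_mul_of_tendsto_eLpNorm (fun k => (H k).memLp_integral hW)
    (fun k => (H k).memLp_integral hW) hY.2.1 hY.2.1 hHY hHY
  rw [hY.integral_mul hW hY, integral_fun_fst (fun t => f t * f t), probReal_univ, one_smul] at hv
  simp_rw [fun t => (pow_two (f t)).symm] at hv
  rw [charFun_gaussianReal, Real.coe_toNNReal _ (integral_nonneg fun ω => sq_nonneg _),
    Complex.ofReal_zero, mul_zero, zero_mul, zero_sub, ← neg_div, ← neg_mul]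
  have hc : Continuous fun v : ℝ => Complex.exp (-(v : ℂ) * t ^ 2 / 2) := by fun_prop
  exact (hc.tendsto _).comp hv

/-- The Itô integral of a deterministic function is a functional of the path of `W`. -/
theorem IsItoIntegral.exists_measurable_comap [IsProbabilityMeasure μ]
    (hW : IsBrownianFor 𝓕 W μ) (hT : 0 ≤ T) {f : ℝ → ℝ} {X : Ω → ℝ}
    (hX : IsItoIntegral 𝓕 W μ T (fun t _ => f t) X)
    (hf : MemLp f 2 (volume.restrict (Set.Icc 0 T))) :
    ∃ Φ : (ℝ≥0 → ℝ) → ℝ, Measurable Φ ∧ X =ᵐ[μ] fun ω => Φ fun t => W t ω := by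
  obtain ⟨Y, hY, H, hd, -, hHY⟩ := exists_isItoIntegral_deterministic hW hT hf
  have hm : TendstoInMeasure μ (fun k => (H k).integral W) atTop Y :=
    tendstoInMeasure_of_tendsto_eLpNorm (by simp)
      (fun k => ((H k).memLp_integral hW).aestronglyMeasurable) hY.2.1.aestronglyMeasurable hHY
  obtain ⟨ns, -, hns⟩ := hm.exists_seq_tendsto_ae
  choose c hc using hd
  -- along a subsequence the elementary integrals converge almost surely; the `limsup` is a
  -- measurable functional of the path whether or not they converge
  refine ⟨fun w => limsup (fun j => ∑ i, c (ns j) i *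
    (w ((H (ns j)).right i) - w ((H (ns j)).left i))) atTop, ?_, ?_⟩
  · exact Measurable.limsup fun j => by fun_prop
  · filter_upwards [hX.ae_eq hW hY, hns] with ω h1 h2
    rw [h1, ← h2.limsup_eq]
    simp [SimpleProcess.integral, hc]

end Wiener

/-! ### Translations of a Gaussian law -/

section Gaussian

variable {v : ℝ≥0}

theorem gaussianPDFReal_shift (hv : v ≠ 0) (θ z : ℝ) :
    gaussianPDFReal (θ * v) v z =
      gaussianPDFReal 0 v z * Real.exp (θ * z - θ ^ 2 * v / 2) := by
  have hv' : (v : ℝ) ≠ 0 := by exact_mod_cast hv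
  rw [gaussianPDFReal, gaussianPDFReal, mul_assoc (√(2 * Real.pi * v))⁻¹, ← Real.exp_add]
  congr 2
  field_simp
  ring

/-- The Cameron–Martin formula on the line. -/
theorem gaussianReal_map_add_eq_withDensity (hv : v ≠ 0) (θ : ℝ) :
    (gaussianReal 0 v).map (· + θ * v) =
      (gaussianReal 0 v).withDensity
        (fun z => ENNReal.ofReal (Real.exp (θ * z - θ ^ 2 * v / 2))) := by
  rw [gaussianReal_map_add_const, zero_add, gaussianReal_of_var_ne_zero _ hv,
    gaussianReal_of_var_ne_zero _ hv, ← withDensity_mul _ (by fun_prop) (by fun_prop)]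
  congr with z
  rw [gaussianPDF, gaussianPDFReal_shift hv, ENNReal.ofReal_mul (gaussianPDFReal_nonneg _ _ _)]
  rfl

theorem integral_gaussianReal_shift (hv : v ≠ 0) (θ : ℝ) {k : ℝ → ℝ} (hk : Measurable k) :
    ∫ z, k (z + θ * v) ∂(gaussianReal 0 v) =
      ∫ z, Real.exp (θ * z - θ ^ 2 * v / 2) * k z ∂(gaussianReal 0 v) := by
  rw [← integral_map (φ := (· + θ * (v : ℝ))) (by fun_prop) hk.aestronglyMeasurable,
    gaussianReal_map_add_eq_withDensity hv,
    integral_withDensity_eq_integral_toReal_smul (by fun_prop) (by simp)]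
  simp [Real.exp_nonneg]

theorem memLp_exp_mul_gaussianReal (c : ℝ) :
    MemLp (fun z => Real.exp (c * z)) 2 (gaussianReal 0 v) := by
  rw [memLp_two_iff_integrable_sq (by fun_prop)]
  refine (integrable_exp_mul_gaussianReal (2 * c)).congr (Eventually.of_forall fun z => ?_)
  simp only [← Real.exp_nat_mul]
  push_cast
  ring_nf

theorem integrable_gaussianReal_shift (hv : v ≠ 0) (θ : ℝ) {k : ℝ → ℝ} (hk : Measurable k)
    (hk2 : MemLp k 2 (gaussianReal 0 v)) :
    Integrable (fun z => k (z + θ * v)) (gaussianReal 0 v) := by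
  change Integrable (k ∘ (· + θ * (v : ℝ))) _
  rw [← integrable_map_measure hk.aestronglyMeasurable (by fun_prop),
    gaussianReal_map_add_eq_withDensity hv,
    integrable_withDensity_iff_integrable_smul' (by fun_prop) (by simp)]
  refine ((integrable_fun_mul (memLp_exp_mul_gaussianReal θ) hk2).const_mul
    (Real.exp (-(θ ^ 2 * v / 2)))).congr (Eventually.of_forall fun z => ?_)
  simp only [ENNReal.toReal_ofReal (Real.exp_nonneg _), smul_eq_mul]
  rw [← mul_assoc, ← Real.exp_add]
  ring_nf

/-- The score identity for the Gaussian location family. Only square integrability of `k` is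
needed because the derivative falls on the density of the shifted law. -/
theorem hasDerivAt_integral_gaussianReal_shift (hv : v ≠ 0) {k : ℝ → ℝ} (hk : Measurable k)
    (hk2 : MemLp k 2 (gaussianReal 0 v)) :
    HasDerivAt (fun θ : ℝ => ∫ z, k (z + θ * v) ∂(gaussianReal 0 v))
      (∫ z, k z * z ∂(gaussianReal 0 v)) 0 := by
  simp_rw [fun θ => integral_gaussianReal_shift hv θ hk]
  have hd : ∀ z θ : ℝ, HasDerivAt (fun θ : ℝ => Real.exp (θ * z - θ ^ 2 * v / 2) * k z)
      (Real.exp (θ * z - θ ^ 2 * v / 2) * (z - θ * v) * k z) θ := fun z θ => by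
    have h1 : HasDerivAt (fun θ : ℝ => θ * z - θ ^ 2 * v / 2) (z - θ * v) θ := by
      have h2 := ((hasDerivAt_id θ).mul_const z).sub
        ((((hasDerivAt_id θ).pow 2).mul_const (v : ℝ)).div_const 2)
      refine h2.congr_deriv ?_
      simp only [id]
      push_cast
      ring
    exact h1.exp.mul_const _
  have hi0 : Integrable k (gaussianReal 0 v) := hk2.integrable (by simp)
  -- on `|θ| < 1` the derivative is at most `(1 + v) (exp (2 z) + exp (-2 z)) |k z|`
  have hbound : ∀ z θ : ℝ, |θ| < 1 →
      ‖Real.exp (θ * z - θ ^ 2 * v / 2) * (z - θ * v) * k z‖ ≤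
        (1 + v) * ((Real.exp (2 * z) + Real.exp (-2 * z)) * ‖k z‖) := fun z θ hθ => by
    have hv0 : (0 : ℝ) ≤ v := v.2
    have h1 : Real.exp (θ * z - θ ^ 2 * v / 2) ≤ Real.exp |z| := by
      refine Real.exp_le_exp.2 ?_
      have : θ * z ≤ |z| := by
        calc θ * z ≤ |θ * z| := le_abs_self _
          _ = |θ| * |z| := abs_mul _ _
          _ ≤ 1 * |z| := by gcongr
          _ = |z| := one_mul _
      have : 0 ≤ θ ^ 2 * v / 2 := by positivity
      linarith
    have h2 : |z - θ * v| ≤ (1 + v) * Real.exp |z| := by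
      have h3 : |z - θ * v| ≤ |z| + v := by
        calc |z - θ * v| ≤ |z| + |θ * v| := abs_sub _ _
          _ = |z| + |θ| * v := by rw [abs_mul, abs_of_nonneg hv0]
          _ ≤ |z| + 1 * v := by gcongr
          _ = |z| + v := by ring
      have h4 : |z| + 1 ≤ Real.exp |z| := Real.add_one_le_exp _
      nlinarith [abs_nonneg z]
    have h3 : Real.exp |z| * Real.exp |z| ≤ Real.exp (2 * z) + Real.exp (-2 * z) := by
      rw [← Real.exp_add]
      rcases abs_cases z with ⟨h, -⟩ | ⟨h, -⟩
      · rw [h, ← two_mul]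
        linarith [Real.exp_pos (-2 * z)]
      · rw [h, show -z + -z = -2 * z by ring]
        linarith [Real.exp_pos (2 * z)]
    rw [norm_mul, norm_mul, Real.norm_eq_abs, Real.abs_exp, Real.norm_eq_abs (z - θ * v)]
    calc Real.exp (θ * z - θ ^ 2 * v / 2) * |z - θ * v| * ‖k z‖
        ≤ Real.exp |z| * ((1 + v) * Real.exp |z|) * ‖k z‖ := by gcongr
      _ = (1 + v) * ((Real.exp |z| * Real.exp |z|) * ‖k z‖) := by ring
      _ ≤ _ := by gcongr
  have hmain := hasDerivAt_integral_of_dominated_loc_of_deriv_le (μ := gaussianReal 0 v)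
    (F := fun θ z => Real.exp (θ * z - θ ^ 2 * v / 2) * k z)
    (F' := fun θ z => Real.exp (θ * z - θ ^ 2 * v / 2) * (z - θ * v) * k z)
    (bound := fun z => (1 + v) * ((Real.exp (2 * z) + Real.exp (-2 * z)) * ‖k z‖))
    (x₀ := 0) (s := Metric.ball 0 1) (Metric.ball_mem_nhds _ one_pos)
    (Eventually.of_forall fun θ => by fun_prop) (by simpa using hi0) (by fun_prop)
    (Eventually.of_forall fun z θ hθ => hbound z θ (by simpa using hθ))
    ((integrable_fun_mul ((memLp_exp_mul_gaussianReal 2).add (memLp_exp_mul_gaussianReal (-2)))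
      hk2.norm).const_mul _)
    (Eventually.of_forall fun z θ _ => hd z θ)
  refine hmain.2.congr_deriv (integral_congr_ae (Eventually.of_forall fun z => ?_))
  simp [mul_comm]

end Gaussian

/-! ### The delta weight -/

section Weight

variable {Ω : Type*} {m : MeasurableSpace Ω} {μ : Measure Ω}
  {𝓕 : Filtration ℝ≥0 m} {W : ℝ≥0 → Ω → ℝ} {T : ℝ}

/-- A pair is jointly Gaussian as soon as all linear combinations of its entries are. -/
theorem hasGaussianLaw_prodMk_of_linearCombination {X Y : Ω → ℝ} (hX : AEMeasurable X μ)
    (hY : AEMeasurable Y μ) (h : ∀ a b : ℝ, HasGaussianLaw (fun ω => a * X ω + b * Y ω) μ) :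
    HasGaussianLaw (fun ω => (X ω, Y ω)) μ := by
  refine ⟨⟨fun L => ?_⟩⟩
  have hXY : AEMeasurable (fun ω => (X ω, Y ω)) μ := hX.prodMk hY
  have hL : HasGaussianLaw (L ∘ fun ω => (X ω, Y ω)) μ := by
    have e : (L ∘ fun ω => (X ω, Y ω)) = fun ω => L (1, 0) * X ω + L (0, 1) * Y ω := by
      ext ω
      have : ((X ω, Y ω) : ℝ × ℝ) = X ω • (1, 0) + Y ω • (0, 1) := by simp
      simp only [Function.comp_apply]
      rw [this, map_add, map_smul, map_smul, smul_eq_mul, smul_eq_mul]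
      ring
    rw [e]
    exact h _ _
  rw [AEMeasurable.map_map_of_aemeasurable (by fun_prop) hXY, hL.map_eq_gaussianReal,
    integral_map hXY (by fun_prop), variance_map (by fun_prop) hXY]
  rfl

/-- Since `Y = F / F(0)`, the paths of `F` cancel and the delta integrand is deterministic. -/
theorem deltaIntegrand_eq (σ : ℝ → ℝ) (x : ℝ) (a : ℝ → ℝ) :
    deltaIntegrand 𝓕 W μ σ x a = fun t _ => a t * (σ t * x)⁻¹ := by
  ext t ω
  rw [deltaIntegrand, diffusionCoeff, futures, firstVariation, ← mul_assoc (σ t), mul_inv (σ t * x),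
    mul_assoc (σ t * x)⁻¹, inv_mul_cancel₀ (Real.exp_ne_zero _), mul_one]

theorem UniformlyElliptic.exists_lt_sq {σ : ℝ → ℝ} (h : UniformlyElliptic σ T) :
    ∃ η : ℝ, 0 < η ∧ ∀ t ∈ Set.Icc 0 T, η < σ t ^ 2 := by
  obtain ⟨η, h0, h⟩ := h
  refine ⟨η, h0, fun t ht => ?_⟩
  have := h 1 one_ne_zero t ht
  simpa [pow_two] using this

theorem UniformlyElliptic.memLp_mul_inv {σ a : ℝ → ℝ} (h : UniformlyElliptic σ T)
    (hσ : MemLp σ 2 (volume.restrict (Set.Icc 0 T)))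
    (ha : MemLp a 2 (volume.restrict (Set.Icc 0 T))) (x : ℝ) :
    MemLp (fun t => a t * (σ t * x)⁻¹) 2 (volume.restrict (Set.Icc 0 T)) := by
  obtain ⟨η, h0, hη⟩ := h.exists_lt_sq
  have hm : AEMeasurable (fun t => a t * (σ t * x)⁻¹) (volume.restrict (Set.Icc 0 T)) :=
    ha.aemeasurable.mul (hσ.aemeasurable.mul_const x).inv
  refine ha.of_le_mul (c := (√η)⁻¹ * |x|⁻¹) hm.aestronglyMeasurable ?_
  filter_upwards [ae_restrict_mem measurableSet_Icc] with t ht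
  have h1 : √η ≤ |σ t| := by
    rw [← Real.sqrt_sq_eq_abs]
    exact Real.sqrt_le_sqrt (hη t ht).le
  rw [Real.norm_eq_abs, Real.norm_eq_abs, abs_mul, abs_inv, abs_mul, mul_inv, mul_comm |a t|]
  have : 0 < √η := Real.sqrt_pos.2 h0
  gcongr

theorem UniformlyElliptic.integral_sq_pos {σ : ℝ → ℝ} (h : UniformlyElliptic σ T) (hT : 0 < T)
    (hσ : MemLp σ 2 (volume.restrict (Set.Icc 0 T))) : 0 < ∫ t in Set.Icc 0 T, σ t ^ 2 := by
  obtain ⟨η, h0, hη⟩ := h.exists_lt_sq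
  calc 0 < T * η := by positivity
    _ = ∫ t in Set.Icc 0 T, η := by simp [hT.le]
    _ ≤ _ := setIntegral_mono_on (integrable_const _) hσ.integrable_sq measurableSet_Icc
      fun t ht => (hη t ht).le

/-- Starting the futures price at `x` instead of `y` translates the stochastic integral in the
exponent by `log (x / y)`, written as `θ s` with `s` the variance of that integral. -/
theorem futures_eq (hT : 0 ≤ T) {σ : ℝ → ℝ} {x y s : ℝ} (hx : 0 < x) (hy : 0 < y) (hs : s ≠ 0)
    (hσ : ∫ t in Set.Icc 0 T, σ t ^ 2 = s) (ω : Ω) :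
    futures 𝓕 W μ σ x T ω =
      y * Real.exp (-(1 / 2) * s +
        (itoIntegral 𝓕 W μ T (fun u _ => σ u) ω + Real.log (x / y) / s * s)) := by
  rw [futures, intervalIntegral.integral_of_le hT, ← integral_Icc_eq_integral_Ioc, hσ,
    div_mul_cancel₀ _ hs, ← add_assoc, Real.exp_add _ (Real.log (x / y)),
    Real.exp_log (div_pos hx hy)]
  field_simp

theorem futures_eq_self (hT : 0 ≤ T) {σ : ℝ → ℝ} {x s : ℝ}
    (hσ : ∫ t in Set.Icc 0 T, σ t ^ 2 = s) (ω : Ω) :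
    futures 𝓕 W μ σ x T ω =
      x * Real.exp (-(1 / 2) * s + itoIntegral 𝓕 W μ T (fun u _ => σ u) ω) := by
  rw [futures, intervalIntegral.integral_of_le hT, ← integral_Icc_eq_integral_Ioc, hσ]

variable [IsProbabilityMeasure μ]

theorem IsItoIntegral.integral_eq_zero (hW : IsBrownianFor 𝓕 W μ) (hT : 0 ≤ T) {f : ℝ → ℝ}
    {X : Ω → ℝ} (hX : IsItoIntegral 𝓕 W μ T (fun t _ => f t) X)
    (hf : MemLp f 2 (volume.restrict (Set.Icc 0 T))) : ∫ ω, X ω ∂μ = 0 := by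
  rw [(hX.hasLaw_gaussianReal hW hT hf).integral_eq, integral_id_gaussianReal]

/-- Itô integrals of deterministic functions that are orthogonal in `L²([0, T])` are
independent: they are jointly Gaussian and uncorrelated. -/
theorem IsItoIntegral.indepFun_of_orthogonal (hW : IsBrownianFor 𝓕 W μ) (hT : 0 ≤ T)
    {f r : ℝ → ℝ} {X R : Ω → ℝ} (hX : IsItoIntegral 𝓕 W μ T (fun t _ => f t) X)
    (hR : IsItoIntegral 𝓕 W μ T (fun t _ => r t) R)
    (hf : MemLp f 2 (volume.restrict (Set.Icc 0 T)))
    (hr : MemLp r 2 (volume.restrict (Set.Icc 0 T)))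
    (horth : ∫ t in Set.Icc 0 T, f t * r t = 0) : IndepFun X R μ := by
  refine HasGaussianLaw.indepFun_of_covariance_eq_zero
    (hasGaussianLaw_prodMk_of_linearCombination hX.2.1.aemeasurable hR.2.1.aemeasurable
      fun a b => ?_) ?_
  · have hw : MemLp (fun t => a * f t + b * r t) 2 (volume.restrict (Set.Icc 0 T)) :=
      (hf.const_mul a).add (hr.const_mul b)
    have hZ := isItoIntegral_itoIntegral_deterministic hW hT hw
    exact (hZ.hasLaw_gaussianReal hW hT hw).hasGaussianLaw.congr
      (hX.ae_eq_linearCombination hW hR hZ (Eventually.of_forall fun p => rfl))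
  · rw [covariance_eq_sub hX.2.1 hR.2.1, hX.integral_eq_zero hW hT hf, zero_mul, sub_zero]
    have := hX.integral_mul hW hR
    rw [integral_fun_fst (fun t => f t * r t), probReal_univ, one_smul, horth] at this
    exact this

/-- Integration by parts for the delta weight: the component `R` of the weight orthogonal to `σ`
is independent of `X` and centred, so only the component `(x ∫ σ²)⁻¹ X` along `X` counts. -/
theorem integral_mul_deltaWeight (hW : IsBrownianFor 𝓕 W μ) (hT : 0 < T) {σ a : ℝ → ℝ}
    (hell : UniformlyElliptic σ T) (hσ : MemLp σ 2 (volume.restrict (Set.Icc 0 T)))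
    (ha : MemLp a 2 (volume.restrict (Set.Icc 0 T))) (ha1 : ∫ t in (0 : ℝ)..T, a t = 1)
    {x : ℝ} {k : ℝ → ℝ} (hk : Measurable k)
    (hk2 : MemLp (fun ω => k (itoIntegral 𝓕 W μ T (fun u _ => σ u) ω)) 2 μ) :
    ∫ ω, k (itoIntegral 𝓕 W μ T (fun u _ => σ u) ω) * deltaWeight 𝓕 W μ σ x a T ω ∂μ =
      (x * ∫ t in Set.Icc 0 T, σ t ^ 2)⁻¹ *
        ∫ ω, k (itoIntegral 𝓕 W μ T (fun u _ => σ u) ω) *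
          itoIntegral 𝓕 W μ T (fun u _ => σ u) ω ∂μ := by
  have hs := hell.integral_sq_pos hT hσ
  set s : ℝ := ∫ t in Set.Icc 0 T, σ t ^ 2 with hsdef
  -- `c σ` is the orthogonal projection of the integrand of the weight onto `σ`
  set c : ℝ := (x * s)⁻¹ with hc
  have hX := isItoIntegral_itoIntegral_deterministic hW hT.le hσ
  set X := itoIntegral 𝓕 W μ T (fun u _ => σ u)
  have hf := hell.memLp_mul_inv hσ ha x
  have hP := isItoIntegral_itoIntegral_deterministic hW hT.le hf
  rw [deltaWeight, deltaIntegrand_eq]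
  set P := itoIntegral 𝓕 W μ T (fun t _ => a t * (σ t * x)⁻¹)
  have hr : MemLp (fun t => a t * (σ t * x)⁻¹ - c * σ t) 2 (volume.restrict (Set.Icc 0 T)) :=
    hf.sub (hσ.const_mul c)
  have hR := isItoIntegral_itoIntegral_deterministic hW hT.le hr
  set R := itoIntegral 𝓕 W μ T (fun t _ => a t * (σ t * x)⁻¹ - c * σ t)
  have horth : ∫ t in Set.Icc 0 T, σ t * (a t * (σ t * x)⁻¹ - c * σ t) = 0 := by
    have e : ∀ t, σ t * (a t * (σ t * x)⁻¹ - c * σ t) =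
        σ t * (a t * (σ t * x)⁻¹) - c * σ t ^ 2 := fun t => by ring
    simp_rw [e]
    rw [integral_sub (integrable_fun_mul hσ hf) (hσ.integrable_sq.const_mul _), integral_const_mul,
      ← hsdef]
    have e2 : ∫ t in Set.Icc 0 T, σ t * (a t * (σ t * x)⁻¹) = x⁻¹ := by
      obtain ⟨η, h0, hη⟩ := hell.exists_lt_sq
      rw [setIntegral_congr_fun (g := fun t => a t * x⁻¹) measurableSet_Icc, integral_mul_const,
        integral_Icc_eq_integral_Ioc, ← intervalIntegral.integral_of_le hT.le, ha1, one_mul]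
      intro t ht
      have : σ t ≠ 0 := by
        rintro h
        have := hη t ht
        rw [h] at this
        norm_num at this
        linarith
      simp only [mul_inv]
      field_simp
    rw [e2, hc, mul_inv, mul_assoc, inv_mul_cancel₀ hs.ne', mul_one, sub_self]
  have hdec : P =ᵐ[μ] fun ω => c * X ω + 1 * R ω :=
    hX.ae_eq_linearCombination hW hR hP (Eventually.of_forall fun p => by ring)
  have hind := hX.indepFun_of_orthogonal hW hT.le hR hσ hr horth
  have hkR : ∫ ω, k (X ω) * R ω ∂μ = 0 := by
    have := hind.integral_fun_comp_mul_comp (f := k) (g := id) hX.2.1.aemeasurable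
      hR.2.1.aemeasurable hk.aestronglyMeasurable measurable_id.aestronglyMeasurable
    simp only [id] at this
    rw [this, hR.integral_eq_zero hW hT.le hr, mul_zero]
  calc ∫ ω, k (X ω) * P ω ∂μ = ∫ ω, (c * (k (X ω) * X ω) + k (X ω) * R ω) ∂μ := by
        refine integral_congr_ae ?_
        filter_upwards [hdec] with ω h
        rw [h]
        ring
    _ = c * ∫ ω, k (X ω) * X ω ∂μ := by
        rw [integral_add ((integrable_fun_mul hk2 hX.2.1).const_mul c)
          (integrable_fun_mul hk2 hR.2.1), hkR, add_zero, integral_const_mul]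

/-- Deterministic Itô integrals against independent Brownian motions are independent. -/
theorem indepFun_isItoIntegral_prodMk {W' : ℝ≥0 → Ω → ℝ} (hW : IsBrownianFor 𝓕 W μ)
    (hW' : IsBrownianFor 𝓕 W' μ) (hind : IndepFun (fun ω t => W t ω) (fun ω t => W' t ω) μ)
    (hT : 0 ≤ T) {f f₁ f₂ : ℝ → ℝ} {X X₁ X₂ : Ω → ℝ}
    (hX : IsItoIntegral 𝓕 W μ T (fun t _ => f t) X)
    (hX₁ : IsItoIntegral 𝓕 W' μ T (fun t _ => f₁ t) X₁)
    (hX₂ : IsItoIntegral 𝓕 W' μ T (fun t _ => f₂ t) X₂)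
    (hf : MemLp f 2 (volume.restrict (Set.Icc 0 T)))
    (hf₁ : MemLp f₁ 2 (volume.restrict (Set.Icc 0 T)))
    (hf₂ : MemLp f₂ 2 (volume.restrict (Set.Icc 0 T))) :
    IndepFun X (fun ω => (X₁ ω, X₂ ω)) μ := by
  obtain ⟨Φ, hΦ, h⟩ := hX.exists_measurable_comap hW hT hf
  obtain ⟨Φ₁, hΦ₁, h₁⟩ := hX₁.exists_measurable_comap hW' hT hf₁
  obtain ⟨Φ₂, hΦ₂, h₂⟩ := hX₂.exists_measurable_comap hW' hT hf₂
  have := hind.comp hΦ (hΦ₁.prodMk hΦ₂)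
  refine this.congr h.symm ?_
  filter_upwards [h₁, h₂] with ω e₁ e₂
  simp [e₁, e₂]

end Weight

end Quanto

/-! ### The temperature delta -/

open Quanto in
theorem mainTheorem2 {Ω : Type*} {m : MeasurableSpace Ω} (Q : Measure Ω) [IsProbabilityMeasure Q]
    (𝓕 : Filtration ℝ≥0 m) (WE WI : ℝ≥0 → Ω → ℝ)
    (hWE : Quanto.IsBrownianFor 𝓕 WE Q) (hWI : Quanto.IsBrownianFor 𝓕 WI Q)
    (hindep : IndepFun (fun ω t => WE t ω) (fun ω t => WI t ω) Q)
    (τ₂ : ℝ) (hτ₂ : 0 < τ₂)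
    (σE σI : ℝ → ℝ)
    (hσE : MemLp σE 2 (volume.restrict (Set.Icc 0 τ₂)))
    (hσI : MemLp σI 2 (volume.restrict (Set.Icc 0 τ₂)))
    (hell : Quanto.UniformlyElliptic σI τ₂)
    (FE0 FI0 : ℝ) (hFE0 : 0 < FE0) (hFI0 : 0 < FI0)
    (g h : ℝ → ℝ) (hg : Measurable g) (hh : Measurable h)
    (hg2 : MemLp (fun ω => g (Quanto.futures 𝓕 WE Q σE FE0 τ₂ ω)) 2 Q)
    (hh2 : MemLp (fun ω => h (Quanto.futures 𝓕 WI Q σI FI0 τ₂ ω)) 2 Q)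
    {n : ℕ} (t : Fin n → ℝ) (ht : ∀ i, t i ∈ Set.Ioc 0 τ₂) (htlast : ∃ i, t i = τ₂)
    (a : ℝ → ℝ) (ha : a ∈ Quanto.Upsilon τ₂ t) :
    Quanto.IsItoIntegral 𝓕 WI Q τ₂ (Quanto.deltaIntegrand 𝓕 WI Q σI FI0 a)
        (Quanto.deltaWeight 𝓕 WI Q σI FI0 a τ₂) ∧
    (∀ x : ℝ, 0 < x → Integrable (fun ω => g (Quanto.futures 𝓕 WE Q σE FE0 τ₂ ω) *
        h (Quanto.futures 𝓕 WI Q σI x τ₂ ω)) Q) ∧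
    Integrable (fun ω => g (Quanto.futures 𝓕 WE Q σE FE0 τ₂ ω) *
        h (Quanto.futures 𝓕 WI Q σI FI0 τ₂ ω) * Quanto.deltaWeight 𝓕 WI Q σI FI0 a τ₂ ω) Q ∧
    HasDerivAt
      (fun x : ℝ => ∫ ω, g (Quanto.futures 𝓕 WE Q σE FE0 τ₂ ω) *
        h (Quanto.futures 𝓕 WI Q σI x τ₂ ω) ∂Q)
      (∫ ω, g (Quanto.futures 𝓕 WE Q σE FE0 τ₂ ω) *
        h (Quanto.futures 𝓕 WI Q σI FI0 τ₂ ω) * Quanto.deltaWeight 𝓕 WI Q σI FI0 a τ₂ ω ∂Q)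
      FI0 := by
  obtain ⟨i, hi⟩ := htlast
  have ha2 := ha.1
  have ha1 : ∫ s in (0 : ℝ)..τ₂, a s = 1 := hi ▸ ha.2 i
  have hXE := isItoIntegral_itoIntegral_deterministic hWE hτ₂.le hσE
  have hX := isItoIntegral_itoIntegral_deterministic hWI hτ₂.le hσI
  have hf := hell.memLp_mul_inv hσI ha2 FI0
  have hP : IsItoIntegral 𝓕 WI Q τ₂ (fun t _ => a t * (σI t * FI0)⁻¹)
      (deltaWeight 𝓕 WI Q σI FI0 a τ₂) := by
    rw [deltaWeight, deltaIntegrand_eq]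
    exact isItoIntegral_itoIntegral_deterministic hWI hτ₂.le hf
  have hind := indepFun_isItoIntegral_prodMk hWE hWI hindep hτ₂.le hXE hX hP hσE hσI hf
  have hs := hell.integral_sq_pos hτ₂ hσI
  have hlaw := hX.hasLaw_gaussianReal hWI hτ₂.le hσI
  have hparts := fun k hk hk2 => integral_mul_deltaWeight (x := FI0) (k := k) hWI hτ₂ hell hσI
    ha2 ha1 hk hk2
  have hfut := fun x (hx : 0 < x) => futures_eq (𝓕 := 𝓕) (W := WI) (μ := Q) hτ₂.le hx hFI0
    hs.ne' rfl
  have hfut0 := futures_eq_self (𝓕 := 𝓕) (W := WI) (μ := Q) (σ := σI) (x := FI0) hτ₂.le rfl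
  set P := deltaWeight 𝓕 WI Q σI FI0 a τ₂
  set X := itoIntegral 𝓕 WI Q τ₂ fun u _ => σI u
  set s := ∫ t in Set.Icc 0 τ₂, σI t ^ 2
  set v : ℝ≥0 := s.toNNReal
  have hvs : (v : ℝ) = s := Real.coe_toNNReal _ hs.le
  have hv : v ≠ 0 := (Real.toNNReal_pos.2 hs).ne'
  -- `h` as a function of the terminal Gaussian variable for the initial value `FI0`
  set k : ℝ → ℝ := fun z => h (FI0 * Real.exp (-(1 / 2) * s + z)) with hkdef
  have hk : Measurable k := hh.comp (by fun_prop)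
  have hk0 : ∀ ω, h (futures 𝓕 WI Q σI FI0 τ₂ ω) = k (X ω) := fun ω => by rw [hfut0]
  have hkx : ∀ x, 0 < x → ∀ ω, h (futures 𝓕 WI Q σI x τ₂ ω) =
      k (X ω + Real.log (x / FI0) / s * v) := fun x hx ω => by rw [hfut x hx, hvs]
  simp_rw [hk0] at hh2 ⊢
  have hk2 : MemLp k 2 (gaussianReal 0 v) := by
    rw [← hlaw.map_eq, memLp_map_measure_iff hk.aestronglyMeasurable hlaw.aemeasurable]
    exact hh2
  have hshift_meas : ∀ θ : ℝ, Measurable fun z => k (z + θ * v) := fun θ => hk.comp (by fun_prop)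
  have hshift : ∀ θ : ℝ, Integrable (fun ω => k (X ω + θ * v)) Q := fun θ => by
    have := integrable_gaussianReal_shift hv θ hk hk2
    rw [← hlaw.map_eq] at this
    exact this.comp_aemeasurable hlaw.aemeasurable
  set G : Ω → ℝ := fun ω => g (futures 𝓕 WE Q σE FE0 τ₂ ω)
  have hGint : Integrable G Q := hg2.integrable (by simp)
  have hGind : ∀ ψ : ℝ × ℝ → ℝ, Measurable ψ → IndepFun G (fun ω => ψ (X ω, P ω)) Q :=
    fun ψ hψ => hind.comp (φ := fun z => g (FE0 * Real.exp
      (-(1 / 2) * (∫ u in (0 : ℝ)..τ₂, σE u ^ 2) + z))) (hg.comp (by fun_prop)) hψ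
  have hGshift : ∀ θ : ℝ, IndepFun G (fun ω => k (X ω + θ * v)) Q := fun θ =>
    hGind (fun p => k (p.1 + θ * v)) ((hshift_meas θ).comp measurable_fst)
  have hGP : IndepFun G (fun ω => k (X ω) * P ω) Q :=
    hGind (fun p => k p.1 * p.2) ((hk.comp measurable_fst).mul measurable_snd)
  have hkP : Integrable (fun ω => k (X ω) * P ω) Q := integrable_fun_mul hh2 hP.2.1
  refine ⟨?_, fun x hx => ?_, ?_, ?_⟩
  · rw [deltaIntegrand_eq]
    exact hP
  · simp_rw [hkx x hx]
    exact (hGshift _).integrable_mul hGint (hshift _)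
  · simp_rw [mul_assoc]
    exact hGP.integrable_mul hGint hkP
  · have hval : ∫ ω, G ω * k (X ω) * P ω ∂Q =
        (∫ ω, G ω ∂Q) * ((∫ z, k z * z ∂(gaussianReal 0 v)) * (FI0 * s)⁻¹) := by
      simp_rw [mul_assoc (G _)]
      rw [hGP.integral_fun_mul_eq_mul_integral hGint.aestronglyMeasurable hkP.aestronglyMeasurable,
        hparts k hk hh2, mul_comm (FI0 * s)⁻¹, ← hlaw.integral_comp
          (f := fun z => k z * z) (hk.mul measurable_id).aestronglyMeasurable]
      rfl
    have hprice : ∀ x, 0 < x → ∫ ω, G ω * h (futures 𝓕 WI Q σI x τ₂ ω) ∂Q =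
        (∫ ω, G ω ∂Q) * ∫ z, k (z + Real.log (x / FI0) / s * v) ∂(gaussianReal 0 v) :=
      fun x hx => by
        simp_rw [hkx x hx]
        rw [(hGshift _).integral_fun_mul_eq_mul_integral hGint.aestronglyMeasurable
          (hshift _).aestronglyMeasurable, ← hlaw.integral_comp
            (f := fun z => k (z + Real.log (x / FI0) / s * v)) (hshift_meas _).aestronglyMeasurable]
        rfl
    have hθ : HasDerivAt (fun x => Real.log (x / FI0) / s) (FI0 * s)⁻¹ FI0 := by
      have h1 := (((hasDerivAt_id FI0).div_const FI0).log (by simp [hFI0.ne'])).div_const s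
      refine h1.congr_deriv ?_
      simp only [id]
      field_simp
    have hθ0 : Real.log (FI0 / FI0) / s = 0 := by rw [div_self hFI0.ne', Real.log_one, zero_div]
    have hscore := hasDerivAt_integral_gaussianReal_shift hv hk hk2
    rw [hval]
    refine ((hscore.comp_of_eq FI0 hθ hθ0.symm).const_mul (∫ ω, G ω ∂Q)).congr_of_eventuallyEq ?_
    -- the formula for the price holds for positive initial values only
    filter_upwards [lt_mem_nhds hFI0] with x hx
    exact hprice x hx
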